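/- For a finite collection $\mathcal F$ of homogeneous polynomials with complex coefficients in fixed variables, the simultaneous Waring rank $\mathrm{rk}_{\mathbb C}\,\mathcal F$ is the least $r$ such that there are linear forms $L_1,\dots,L_r$ with the property that every $F\in\mathcal F$ can be written as $F=\sum_{j=1}^r\lambda_j L_j^{\deg F}$ with $\lambda_j\in\mathbb C$ (depending on $F$); put $\mathrm{rk}_{\mathbb C}\,F=\mathrm{rk}_{\mathbb C}\{F\}$. **Theorem.** Let $s,r,\ell\ge 0$, and in the polynomial ring $\mathbb C[x_0,y_1,\dots,y_s,z_1,\dots,z_r,t_1,\dots,t_\ell]$ let $$M_1=x_0\,y_1^{a_1}\cdots y_s^{a_s}\,z_1^{b_1}\cdots z_r^{b_r},\qquad M_2=x_0\,y_1^{c_1}\cdots y_s^{c_s}\,t_1^{d_1}\cdots t_\ell^{d_\ell},$$ where all $b_i,d_i\ge 2$ and all $a_i,c_i\ge 0$, and where no variable $y_i$ occurs in exactly one of the two monomials with exponent $1$ (that is, $\{a_i,c_i\}\ne\{0,1\}$ for every $i$). Let $M_{12}$ be a greatest common divisor of $M_1$ and $M_2$. Then $$\mathrm{rk}_{\mathbb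 C}\{M_1,M_2\}=\mathrm{rk}_{\mathbb C}\,M_1+\mathrm{rk}_{\mathbb C}\,M_2-\mathrm{rk}_{\mathbb C}\,M_{12}.$$ In particular, if $s=0$, so that $M_1=x_0z_1^{b_1}\cdots z_r^{b_r}$ and $M_2=x_0t_1^{d_1}\cdots t_\ell^{d_\ell}$ have only $x_0$ in common, then $$\mathrm{rk}_{\mathbb C}\{M_1,M_2\}=\mathrm{rk}_{\mathbb C}\,M_1+\mathrm{rk}_{\mathbb C}\,M_2-1.$$ -/

import Mathlib

open MvPolynomial

/-- `L₁, …, L_r` are linear forms such that every member `F` of the collection `𝓕` can be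
written as `F = ∑ j, lam j • (L j) ^ (deg F)` with complex coefficients `lam j` depending on `F`. -/
def SimultaneouslyDecomposes {σ : Type*} {r : ℕ} (L : Fin r → MvPolynomial σ ℂ)
    (𝓕 : Set (MvPolynomial σ ℂ)) : Prop :=
  (∀ j, (L j).IsHomogeneous 1) ∧
    ∀ F ∈ 𝓕, ∃ lam : Fin r → ℂ, F = ∑ j, lam j • L j ^ F.totalDegree

/-- The simultaneous Waring rank over `ℂ` of a collection of forms: the least `r` such that some
`r` linear forms decompose all members simultaneously. (Over `ℂ` every form is a linear combination
of powers of linear forms, so for a finite collection of forms such an `r` exists.) -/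
noncomputable def simRank {σ : Type*} (𝓕 : Set (MvPolynomial σ ℂ)) : ℕ :=
  sInf {r : ℕ | ∃ L : Fin r → MvPolynomial σ ℂ, SimultaneouslyDecomposes L 𝓕}

/-- The complex Waring rank of a single form. -/
noncomputable def waringRank {σ : Type*} (F : MvPolynomial σ ℂ) : ℕ :=
  simRank {F}

/-- `G` is a greatest common divisor of `A` and `B`; over `ℂ` it is unique up to a nonzero scalar. -/
def IsGreatestCommonDivisor {σ : Type*} (G A B : MvPolynomial σ ℂ) : Prop :=
  G ∣ A ∧ G ∣ B ∧ ∀ D : MvPolynomial σ ℂ, D ∣ A → D ∣ B → D ∣ G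

/-- The set of variables `x₀, y₁, …, y_s, z₁, …, z_r, t₁, …, t_l`. -/
abbrev Var (s r l : ℕ) : Type := Option (Fin s ⊕ Fin r ⊕ Fin l)

namespace Var

/-- The variable `x₀`. -/
def x₀ {s r l : ℕ} : Var s r l := none

/-- The variables `y_i`. -/
def y {s r l : ℕ} (i : Fin s) : Var s r l := some (Sum.inl i)

/-- The variables `z_i`. -/
def z {s r l : ℕ} (i : Fin r) : Var s r l := some (Sum.inr (Sum.inl i))

/-- The variables `t_i`. -/
def t {s r l : ℕ} (i : Fin l) : Var s r l := some (Sum.inr (Sum.inr i))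

end Var

/-!
Write the monomials as `x₀ * x ^ α` and `x₀ * x ^ γ`, with `α` and `γ` not involving `x₀`.

*Lower bound.* The coefficient vectors of the linear forms of a simultaneous decomposition are
points apolar to both monomials. Homogenize with respect to `x₀` the polynomials all of whose
exponents lie below `α` or below `γ`, in a fixed large degree. If such a homogenization vanished at
all the points, so would `x₀` times the homogenization in the least possible degree, and multiplying
this by a monomial gives a form whose coefficient at `x₀ * x ^ α` or `x₀ * x ^ γ` is a leading
coefficient of the polynomial, against apolarity. Evaluation at the points is thus injective, and
there are at least as many points as exponents in `Iic α ∪ Iic γ`.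

*Upper bound.* The divided difference over `n + 1` nodes of sum zero extracts the coefficient of
`u ^ n` from polynomials in `u` of degree at most `n + 1`, so a grid with `x₀ = 1` and `α i + 1`
nodes of sum zero in every other coordinate decomposes `x₀ * x ^ α`. Node sets of sum zero and of
sizes `m + 1 ≤ n + 1` can be nested unless the sizes are `1` and `2`. The grids for `α` and `γ` can
therefore be chosen to meet in a grid of the size of `Iic (α ⊓ γ)`, and their union has as many
points as `Iic α ∪ Iic γ`.
-/

open Finsupp (single)

section LinearForms

variable {σ κ R : Type*}

theorem multinomial_cast_ne_zero [Semiring R] [CharZero R] (m : σ →₀ ℕ) :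
    (m.multinomial : R) ≠ 0 :=
  Nat.cast_ne_zero.mpr (Nat.multinomial_pos m.support m).ne'

variable [Fintype σ]

/-- The linear form with coefficient vector `a`. -/
noncomputable def linearForm [CommSemiring R] (a : σ → R) : MvPolynomial σ R :=
  ∑ i, a i • X i

theorem isHomogeneous_linearForm [CommSemiring R] (a : σ → R) :
    (linearForm a).IsHomogeneous 1 :=
  IsHomogeneous.sum _ _ _ fun i _ => by
    rw [smul_eq_C_mul]
    exact isHomogeneous_C_mul_X _ _

theorem exists_linearForm_eq [CommSemiring R] {L : MvPolynomial σ R} (hL : L.IsHomogeneous 1) :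
    ∃ a : σ → R, linearForm a = L := by
  have hspan : L ∈ homogeneousSubmodule σ R 1 := hL
  rw [homogeneousSubmodule_one_eq_span_X] at hspan
  exact Submodule.mem_span_range_iff_exists_fun R |>.mp hspan

theorem coeff_linearForm_pow [CommSemiring R] (a : σ → R) (m : σ →₀ ℕ) (n : ℕ) :
    coeff m (linearForm a ^ n) =
      if m.degree = n then m.multinomial * ∏ i, a i ^ m i else 0 := by
  rw [linearForm, coeff_linearCombination_X_pow_of_fintype,
    Finsupp.prod_fintype _ _ fun i => pow_zero (a i)]
  rfl

theorem monomial_eq_sum_smul_linearForm_pow_iff [CommSemiring R] [NoZeroDivisors R] [CharZero R]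
    [Fintype κ] [DecidableEq σ] {p : κ → σ → R} {lam : κ → R} {m₀ : σ →₀ ℕ} :
    monomial m₀ 1 = ∑ j, lam j • linearForm (p j) ^ m₀.degree ↔
      ∀ m : σ →₀ ℕ, m.degree = m₀.degree →
        m₀.multinomial * ∑ j, lam j * ∏ i, p j i ^ m i = if m = m₀ then 1 else 0 := by
  have coeff_sum_eq (m : σ →₀ ℕ) : coeff m (∑ j, lam j • linearForm (p j) ^ m₀.degree) =
      if m.degree = m₀.degree then m.multinomial * ∑ j, lam j * ∏ i, p j i ^ m i else 0 := by
    simp only [coeff_sum, coeff_smul, coeff_linearForm_pow, smul_eq_mul]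
    split_ifs with h
    · simp only [Finset.mul_sum, mul_left_comm]
    · simp only [mul_zero, Finset.sum_const_zero]
  simp only [MvPolynomial.ext_iff, coeff_sum_eq, coeff_monomial, eq_comm (a := m₀)]
  refine forall_congr' fun m => ?_
  obtain rfl | hne := eq_or_ne m m₀
  · simp only [if_true, forall_const, eq_comm]
  · simp only [hne, if_false, eq_comm (a := (0 : R)), ite_eq_right_iff, mul_eq_zero,
      multinomial_cast_ne_zero, false_or]

end LinearForms

section Apolarity

variable {σ κ R : Type*}

/-- The points `p j` are apolar to the monomial `x ^ m`: every form of degree `|m|` vanishing at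
all of them has zero coefficient at `m`. In characteristic zero this says that the forms of degree
`|m|` in the ideal of the points annihilate `x ^ m` under differentiation. -/
def IsApolarFamily [CommSemiring R] (p : κ → σ → R) (m : σ →₀ ℕ) : Prop :=
  ∀ P : MvPolynomial σ R, P.IsHomogeneous m.degree → (∀ j, eval (p j) P = 0) → coeff m P = 0

theorem isApolarFamily_of_monomial_eq_sum [CommSemiring R] [NoZeroDivisors R] [CharZero R]
    [Fintype σ] [Fintype κ] {p : κ → σ → R} {lam : κ → R} {m₀ : σ →₀ ℕ}
    (h : monomial m₀ 1 = ∑ j, lam j • linearForm (p j) ^ m₀.degree) : IsApolarFamily p m₀ := by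
  classical
  rw [monomial_eq_sum_smul_linearForm_pow_iff] at h
  intro P hP hvan
  calc coeff m₀ P
    _ = ∑ m ∈ P.support, coeff m P * if m = m₀ then 1 else 0 := by simp
    _ = ∑ m ∈ P.support, coeff m P * (m₀.multinomial * ∑ j, lam j * ∏ i, p j i ^ m i) := by
      refine Finset.sum_congr rfl fun m hm => ?_
      rw [h m (by_contra fun hne => mem_support_iff.mp hm (hP.coeff_eq_zero hne))]
    _ = m₀.multinomial * ∑ j, lam j * eval (p j) P := by
      simp only [eval_eq', Finset.mul_sum]
      rw [Finset.sum_comm]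
      refine Finset.sum_congr rfl fun j _ => Finset.sum_congr rfl fun m _ => ?_
      ring
    _ = 0 := by simp only [hvan, mul_zero, Finset.sum_const_zero]

end Apolarity

section Homogenization

variable {σ R : Type*} [CommSemiring R] {x₀ : σ} {d : ℕ} {f : MvPolynomial σ R}

/-- The homogenization in degree `d` with respect to the variable `x₀`: the linear map sending
`x ^ e` to `x₀ ^ (d - |e|) * x ^ e`. The subtraction truncates, so it is only meaningful on
polynomials of total degree at most `d`. -/
noncomputable def homogenization (x₀ : σ) (d : ℕ) : MvPolynomial σ R →ₗ[R] MvPolynomial σ R :=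
  (basisMonomials σ R).constr R fun e => monomial (e + single x₀ (d - e.degree)) 1

theorem homogenization_apply (x₀ : σ) (d : ℕ) (f : MvPolynomial σ R) :
    homogenization x₀ d f =
      ∑ e ∈ f.support, monomial (e + single x₀ (d - e.degree)) (coeff e f) := by
  rw [homogenization, Module.Basis.constr_apply]
  exact Finset.sum_congr rfl fun e _ => by
    beta_reduce
    rw [smul_monomial, smul_eq_mul, mul_one]
    rfl

theorem isHomogeneous_homogenization (hd : f.totalDegree ≤ d) :
    (homogenization x₀ d f).IsHomogeneous d := by
  rw [homogenization_apply]
  refine IsHomogeneous.sum _ _ _ fun e he => isHomogeneous_monomial _ ?_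
  have hed : e.degree ≤ d := (le_totalDegree he).trans hd
  rw [map_add, Finsupp.degree_single, add_tsub_cancel_of_le hed]

theorem homogenization_add (hd : f.totalDegree ≤ d) (n : ℕ) :
    homogenization x₀ (d + n) f = X x₀ ^ n * homogenization x₀ d f := by
  simp only [homogenization_apply, Finset.mul_sum, X_pow_eq_monomial, monomial_mul, one_mul]
  refine Finset.sum_congr rfl fun e he => ?_
  have hed : e.degree ≤ d := (le_totalDegree he).trans hd
  rw [Nat.sub_add_comm hed, Finsupp.single_add, ← add_assoc,
    add_comm (single x₀ n)]

theorem coeff_homogenization {e₀ : σ →₀ ℕ} (hf : ∀ e ∈ f.support, e x₀ = 0)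
    (he₀ : e₀ ∈ f.support) :
    coeff e₀ (homogenization x₀ e₀.degree f) = coeff e₀ f := by
  classical
  rw [homogenization_apply, coeff_sum, Finset.sum_eq_single_of_mem e₀ he₀]
  · rw [tsub_self, Finsupp.single_zero, add_zero, coeff_monomial, if_pos rfl]
  · intro e he hne
    rw [coeff_monomial, if_neg]
    intro heq
    have hx₀ : single x₀ (e₀.degree - e.degree) x₀ = 0 := by
      simpa [hf e he, hf e₀ he₀] using DFunLike.congr_fun heq x₀
    rw [Finsupp.single_eq_same] at hx₀
    rw [hx₀, Finsupp.single_zero, add_zero] at heq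
    exact hne heq

end Homogenization

section LowerBound

variable {σ κ R : Type*} [CommRing R] [IsDomain R] {x₀ : σ} {p : κ → σ → R}

/-- The form `x₀ * h`, with `h` the homogenization of `f` in degree `deg f`, vanishes wherever a
homogenization of `f` in higher degree does, and so does `P = x₀ * h * x ^ (α - e₀)` for every
`e₀ ≤ α`. When `e₀` is a leading exponent of `f`, its coefficient there is the coefficient of `P`
at `x₀ * x ^ α`. -/
theorem eq_zero_of_eval_homogenization_eq_zero {f : MvPolynomial σ R} {d : ℕ}
    (hf : ∀ e ∈ f.support, e x₀ = 0)
    (hp : ∀ e ∈ f.support, ∃ α, e ≤ α ∧ IsApolarFamily p (single x₀ 1 + α))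
    (hd : f.totalDegree < d) (hvan : ∀ j, eval (p j) (homogenization x₀ d f) = 0) : f = 0 := by
  by_contra hne
  obtain ⟨e₀, he₀, hmax⟩ := f.support.exists_mem_eq_sup (support_nonempty.mpr hne)
    fun e => e.sum fun _ k => k
  replace hmax : f.totalDegree = e₀.degree := hmax
  obtain ⟨α, hα, hapolar⟩ := hp e₀ he₀
  set h := homogenization x₀ e₀.degree f with hh
  obtain ⟨n, hn⟩ := Nat.exists_eq_add_of_lt (hmax ▸ hd)
  have hXh (j : κ) : eval (p j) (X x₀ * h) = 0 := by
    have := hvan j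
    rw [hn, add_assoc, homogenization_add hmax.le, map_mul, map_pow, mul_eq_zero,
      pow_eq_zero_iff n.succ_ne_zero] at this
    rwa [map_mul, mul_eq_zero]
  have hP : (X x₀ * h * monomial (α - e₀) 1).IsHomogeneous (single x₀ 1 + α).degree := by
    have hdeg : (single x₀ 1 + α).degree = 1 + e₀.degree + (α - e₀).degree := by
      rw [map_add, Finsupp.degree_single, add_assoc, ← map_add, add_tsub_cancel_of_le hα]
    rw [hdeg]
    exact ((isHomogeneous_X R x₀).mul (isHomogeneous_homogenization hmax.le)).mul
      (isHomogeneous_monomial 1 rfl)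
  have hcoeff : coeff (single x₀ 1 + α) (X x₀ * h * monomial (α - e₀) 1) = coeff e₀ f := by
    rw [← add_tsub_cancel_of_le hα, add_tsub_cancel_left, ← add_assoc, coeff_mul_monomial, mul_one,
      coeff_X_mul, hh, coeff_homogenization hf he₀]
  refine mem_support_iff.mp he₀ (hcoeff ▸ hapolar _ hP fun j => ?_)
  rw [map_mul, hXh, zero_mul]

theorem card_le_card_of_isApolarFamily [Fintype κ] {E : Finset (σ →₀ ℕ)}
    (hE : ∀ e ∈ E, e x₀ = 0)
    (hp : ∀ e ∈ E, ∃ α, e ≤ α ∧ IsApolarFamily p (single x₀ 1 + α)) :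
    E.card ≤ Fintype.card κ := by
  let d := E.sup Finsupp.degree
  let evaluation : restrictSupport R (E : Set (σ →₀ ℕ)) →ₗ[R] κ → R :=
    LinearMap.pi (fun j => (aeval (p j)).toLinearMap) ∘ₗ homogenization x₀ (d + 1) ∘ₗ
      Submodule.subtype _
  have hinj : Function.Injective evaluation := by
    rw [injective_iff_map_eq_zero]
    rintro ⟨f, hfE⟩ hf
    have hsupp : ∀ e ∈ f.support, e ∈ E := fun e he => (mem_restrictSupport_iff R).mp hfE he
    have htotal : f.totalDegree ≤ d :=
      Finset.sup_le fun e he => Finset.le_sup (f := Finsupp.degree) (hsupp e he)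
    refine Subtype.ext (eq_zero_of_eval_homogenization_eq_zero (x₀ := x₀) (p := p)
      (fun e he => hE e (hsupp e he)) (fun e he => hp e (hsupp e he))
      (Nat.lt_succ_of_le htotal) fun j => ?_)
    simpa [evaluation, aeval_eq_eval] using congrFun hf j
  have hfinrank : Module.finrank R (restrictSupport R (E : Set (σ →₀ ℕ))) = E.card := by
    rw [Module.finrank_eq_card_basis (basisRestrictSupport R (E : Set (σ →₀ ℕ)))]
    exact Fintype.card_coe E
  rw [← hfinrank, ← Module.finrank_fintype_fun_eq_card R]
  exact LinearMap.finrank_le_finrank_of_injective hinj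

end LowerBound

section CentredNodes

theorem exists_finset_int_card_eq_sum_eq_zero {k : ℕ} (hk : 2 ≤ k) :
    ∃ D : Finset ℤ, D.card = k ∧ ∑ u ∈ D, u = 0 ∧ 0 ∉ D := by
  let P : Finset ℤ := Finset.Icc 1 (k - 1)
  have hP : 0 < ∑ u ∈ P, u := by
    refine Finset.sum_pos (fun u hu => (Finset.mem_Icc.mp hu).1) (Finset.nonempty_Icc.mpr ?_)
    omega
  have hnotMem : -∑ u ∈ P, u ∉ P := fun h => by
    have := (Finset.mem_Icc.mp h).1
    omega
  refine ⟨insert (-∑ u ∈ P, u) P, ?_, ?_, ?_⟩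
  · rw [Finset.card_insert_of_notMem hnotMem, Int.card_Icc]
    omega
  · rw [Finset.sum_insert hnotMem, neg_add_cancel]
  · rw [Finset.mem_insert, zero_eq_neg, Finset.mem_Icc, not_or]
    exact ⟨hP.ne', by omega⟩

variable {K : Type*} [Field K]

section Existence

variable [CharZero K]

theorem exists_finset_card_eq_sum_eq_zero_disjoint (T : Finset K) {k : ℕ} (hk : 2 ≤ k) :
    ∃ D : Finset K, D.card = k ∧ ∑ u ∈ D, u = 0 ∧ Disjoint D T := by
  classical
  obtain ⟨D, hcard, hsum, hD⟩ := exists_finset_int_card_eq_sum_eq_zero hk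
  obtain ⟨c, hc⟩ :=
    Infinite.exists_notMem_finset (insert 0 ((D ×ˢ T).image fun q : ℤ × K => q.2 / (q.1 : K)))
  rw [Finset.mem_insert, not_or] at hc
  have hinj : Function.Injective fun u : ℤ => c * u :=
    (mul_right_injective₀ hc.1).comp Int.cast_injective
  refine ⟨D.image fun u : ℤ => c * u, by rw [Finset.card_image_of_injective D hinj, hcard], ?_, ?_⟩
  · rw [Finset.sum_image hinj.injOn, ← Finset.mul_sum, ← Int.cast_sum, hsum, Int.cast_zero,
      mul_zero]
  · rw [Finset.disjoint_left]
    intro t ht htT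
    obtain ⟨u, hu, rfl⟩ := Finset.mem_image.mp ht
    have hu0 : (u : K) ≠ 0 := Int.cast_ne_zero.mpr (ne_of_mem_of_not_mem hu hD)
    exact hc.2 (Finset.mem_image.mpr
      ⟨(u, c * u), Finset.mk_mem_product hu htT, mul_div_cancel_right₀ c hu0⟩)

theorem exists_nested_finset_sum_eq_zero {m n : ℕ} (hmn : m ≤ n) (h : m = 0 → n ≠ 1) :
    ∃ A B : Finset K, A ⊆ B ∧ A.card = m + 1 ∧ B.card = n + 1 ∧
      ∑ u ∈ A, u = 0 ∧ ∑ u ∈ B, u = 0 := by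
  classical
  obtain ⟨A, hA, hA0, h0⟩ : ∃ A : Finset K, A.card = m + 1 ∧ ∑ u ∈ A, u = 0 ∧
      (m ≠ 0 → (0 : K) ∉ A) := by
    obtain rfl | hm := eq_or_ne m 0
    · exact ⟨{0}, by simp⟩
    · obtain ⟨D, hD, hD0, hdisj⟩ :=
        exists_finset_card_eq_sum_eq_zero_disjoint ({0} : Finset K) (k := m + 1) (by omega)
      exact ⟨D, hD, hD0, fun _ => Finset.disjoint_singleton_right.mp hdisj⟩
  obtain rfl | rfl | hlt : n = m ∨ n = m + 1 ∨ m + 2 ≤ n := by omega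
  · exact ⟨A, A, subset_rfl, hA, hA, hA0, hA0⟩
  · have h0A : (0 : K) ∉ A := h0 fun hm => h hm (by omega)
    exact ⟨A, insert 0 A, Finset.subset_insert _ _, hA,
      by rw [Finset.card_insert_of_notMem h0A, hA], hA0,
      by rw [Finset.sum_insert h0A, hA0, add_zero]⟩
  · obtain ⟨D, hD, hD0, hdisj⟩ :=
      exists_finset_card_eq_sum_eq_zero_disjoint A (k := n - m) (by omega)
    refine ⟨A, A ∪ D, Finset.subset_union_left, hA, ?_, hA0, ?_⟩
    · rw [Finset.card_union_of_disjoint hdisj.symm]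
      omega
    · rw [Finset.sum_union hdisj.symm, hA0, hD0, add_zero]

theorem exists_finset_sum_eq_zero_card_inter [DecidableEq K] {m n : ℕ}
    (h : (n = 0 → m ≠ 1) ∧ (m = 0 → n ≠ 1)) :
    ∃ A B : Finset K, A.card = m + 1 ∧ B.card = n + 1 ∧ ∑ u ∈ A, u = 0 ∧ ∑ u ∈ B, u = 0 ∧
      (A ∩ B).card = min m n + 1 := by
  rcases le_total m n with hmn | hmn
  · obtain ⟨A, B, hsub, hA, hB, hA0, hB0⟩ := exists_nested_finset_sum_eq_zero (K := K) hmn h.2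
    exact ⟨A, B, hA, hB, hA0, hB0, by rw [Finset.inter_eq_left.mpr hsub, hA, min_eq_left hmn]⟩
  · obtain ⟨B, A, hsub, hB, hA, hB0, hA0⟩ := exists_nested_finset_sum_eq_zero (K := K) hmn h.1
    exact ⟨A, B, hA, hB, hA0, hB0, by rw [Finset.inter_eq_right.mpr hsub, hB, min_eq_right hmn]⟩

end Existence

section Weights

open Lagrange (nodal nodalWeight)

theorem sum_nodalWeight_mul_eval {ι : Type*} [DecidableEq ι] {s : Finset ι} {v : ι → K}
    (hv : Set.InjOn v s) {P : Polynomial K} (hP : P.degree < s.card) :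
    ∑ i ∈ s, nodalWeight s v i * P.eval (v i) = P.coeff (s.card - 1) := by
  rw [Lagrange.coeff_eq_sum hv hP]
  refine Finset.sum_congr rfl fun i _ => ?_
  rw [nodalWeight, Finset.prod_inv_distrib, div_eq_inv_mul]

theorem sum_nodalWeight_mul_pow [DecidableEq K] {A : Finset K} {n k : ℕ} (hA : A.card = n + 1)
    (hsum : ∑ u ∈ A, u = 0) (hk : k ≤ n + 1) :
    ∑ u ∈ A, nodalWeight A id u * u ^ k = if k = n then 1 else 0 := by
  obtain hlt | rfl := hk.lt_or_eq
  · have hdeg : (Polynomial.X ^ k : Polynomial K).degree < A.card := by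
      rw [Polynomial.degree_X_pow, hA]
      exact_mod_cast hlt
    simpa [hA, Polynomial.coeff_X_pow, eq_comm] using
      sum_nodalWeight_mul_eval (Set.injOn_id _) hdeg
  · -- Subtracting the nodal polynomial does not change the values at the nodes.
    have hdeg : (Polynomial.X ^ (n + 1) - nodal A id : Polynomial K).degree < A.card := by
      rw [hA, ← Polynomial.degree_X_pow (R := K) (n + 1)]
      refine Polynomial.degree_sub_lt_left ?_ (Polynomial.monic_X_pow _).ne_zero ?_
      · rw [Polynomial.degree_X_pow, Lagrange.degree_nodal, hA]
      · rw [Polynomial.leadingCoeff_X_pow, Lagrange.nodal_monic.leadingCoeff]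
    have hcoeff : (nodal A id : Polynomial K).coeff n = 0 := by
      have := Polynomial.prod_X_sub_C_coeff_card_pred A id (by omega)
      simpa [nodal, hA, hsum] using this
    calc ∑ u ∈ A, nodalWeight A id u * u ^ (n + 1)
      _ = ∑ u ∈ A, nodalWeight A id u * (Polynomial.X ^ (n + 1) - nodal A id).eval (id u) := by
        refine Finset.sum_congr rfl fun u hu => ?_
        rw [Polynomial.eval_sub, Lagrange.eval_nodal_at_node hu, sub_zero, Polynomial.eval_pow,
          Polynomial.eval_X, id]
      _ = if n + 1 = n then 1 else 0 := by
        rw [sum_nodalWeight_mul_eval (Set.injOn_id _) hdeg, hA, Nat.add_sub_cancel,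
          Polynomial.coeff_sub, hcoeff, Polynomial.coeff_X_pow, sub_zero]
        simp

end Weights

end CentredNodes

section CentredGrids

open Lagrange (nodalWeight)

variable {σ K : Type*} [Field K] {x₀ : σ} {α γ : σ →₀ ℕ}

/-- The sets `A i` are the factors of a grid of points with `x₀`-coordinate `1`, having `α i + 1`
values of sum zero in every other coordinate `i`. Such a grid carries a decomposition of
`x₀ * x ^ α`. -/
structure IsCentredGrid (x₀ : σ) (α : σ →₀ ℕ) (A : σ → Finset K) : Prop where
  card_eq : ∀ i, (A i).card = α i + 1
  eq_one : A x₀ = {1}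
  sum_eq_zero : ∀ i, i ≠ x₀ → ∑ u ∈ A i, u = 0

theorem isCentredGrid_update [DecidableEq σ] {A : σ → Finset K} (hα : α x₀ = 0)
    (hcard : ∀ i, (A i).card = α i + 1) (hsum : ∀ i, ∑ u ∈ A i, u = 0) :
    IsCentredGrid x₀ α (Function.update A x₀ {1}) where
  card_eq i := by
    obtain rfl | hi := eq_or_ne i x₀
    · rw [Function.update_self, Finset.card_singleton, hα]
    · rw [Function.update_of_ne hi, hcard]
  eq_one := Function.update_self ..
  sum_eq_zero i hi := by rw [Function.update_of_ne hi, hsum]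

theorem exists_isCentredGrid_pair [CharZero K] [DecidableEq K] (hα : α x₀ = 0) (hγ : γ x₀ = 0)
    (h : ∀ i, (γ i = 0 → α i ≠ 1) ∧ (α i = 0 → γ i ≠ 1)) :
    ∃ A B : σ → Finset K, IsCentredGrid x₀ α A ∧ IsCentredGrid x₀ γ B ∧
      ∀ i, (A i ∩ B i).card = (α ⊓ γ) i + 1 := by
  classical
  choose A B hA hB hA0 hB0 hAB using fun i => exists_finset_sum_eq_zero_card_inter (K := K) (h i)
  refine ⟨Function.update A x₀ {1}, Function.update B x₀ {1}, isCentredGrid_update hα hA hA0,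
    isCentredGrid_update hγ hB hB0, fun i => ?_⟩
  rw [Finsupp.inf_apply]
  obtain rfl | hi := eq_or_ne i x₀
  · rw [Function.update_self, Function.update_self, Finset.inter_self, Finset.card_singleton, hα,
      hγ, min_self]
  · rw [Function.update_of_ne hi, Function.update_of_ne hi, hAB]

theorem exists_eq_single_add_of_degree_eq {m : σ →₀ ℕ} (hle : α ≤ m)
    (hdeg : m.degree = α.degree + 1) : ∃ j, m = single j 1 + α := by
  obtain ⟨e, rfl⟩ := exists_add_of_le hle
  rw [map_add, Nat.add_left_cancel_iff] at hdeg
  obtain ⟨j, rfl⟩ := (Finsupp.sum_eq_one_iff e).mp hdeg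
  exact ⟨j, add_comm _ _⟩

namespace IsCentredGrid

variable {A : σ → Finset K}

theorem apply_eq_zero (h : IsCentredGrid x₀ α A) : α x₀ = 0 := by
  simpa [h.eq_one] using h.card_eq x₀

theorem sum_nodalWeight_mul_pow [DecidableEq K] (h : IsCentredGrid x₀ α A)
    {i : σ} (hi : i ≠ x₀) {k : ℕ} (hk : k ≤ α i + 1) :
    ∑ u ∈ A i, nodalWeight (A i) id u * u ^ k = if k = α i then 1 else 0 :=
  _root_.sum_nodalWeight_mul_pow (h.card_eq i) (h.sum_eq_zero i hi) hk

theorem sum_nodalWeight_mul_pow_self [DecidableEq K] (h : IsCentredGrid x₀ α A) (k : ℕ) :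
    ∑ u ∈ A x₀, nodalWeight (A x₀) id u * u ^ k = 1 := by
  simp [h.eq_one, nodalWeight]

variable [Fintype σ] [DecidableEq σ]

/-- An exponent of degree `|α| + 1` which is not above `α` is killed by a factor where it is too
small, and `x_j * x ^ α` with `j ≠ x₀` by its factor `j`, where the nodes are centred. -/
theorem sum_prod_nodalWeight_mul_prod_pow [DecidableEq K] (h : IsCentredGrid x₀ α A)
    {m : σ →₀ ℕ} (hm : m.degree = (single x₀ 1 + α).degree) :
    ∑ q ∈ Fintype.piFinset A, (∏ i, nodalWeight (A i) id (q i)) * ∏ i, q i ^ m i =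
      if m = single x₀ 1 + α then 1 else 0 := by
  simp only [← Finset.prod_mul_distrib]
  rw [← Finset.prod_univ_sum A fun i u => nodalWeight (A i) id u * u ^ m i]
  by_cases hle : α ≤ m
  · rw [map_add, Finsupp.degree_single, add_comm] at hm
    obtain ⟨j, rfl⟩ := exists_eq_single_add_of_degree_eq hle hm
    obtain rfl | hj := eq_or_ne j x₀
    · rw [if_pos rfl]
      refine Finset.prod_eq_one fun i _ => ?_
      obtain rfl | hi := eq_or_ne i j
      · exact h.sum_nodalWeight_mul_pow_self _
      · rw [Finsupp.add_apply, Finsupp.single_eq_of_ne hi, zero_add,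
          h.sum_nodalWeight_mul_pow hi (Nat.le_succ _), if_pos rfl]
    · rw [if_neg (by simpa [Finsupp.single_left_inj] using hj)]
      refine Finset.prod_eq_zero (Finset.mem_univ j) ?_
      rw [Finsupp.add_apply, Finsupp.single_eq_same, add_comm,
        h.sum_nodalWeight_mul_pow hj le_rfl, if_neg (Nat.succ_ne_self _)]
  · rw [if_neg (by rintro rfl; exact hle le_add_self)]
    obtain ⟨i, hi⟩ : ∃ i, m i < α i := by simpa [Finsupp.le_def] using hle
    have hix₀ : i ≠ x₀ := by
      rintro rfl
      exact absurd hi (by simp [h.apply_eq_zero])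
    refine Finset.prod_eq_zero (Finset.mem_univ i) ?_
    rw [h.sum_nodalWeight_mul_pow hix₀ (by omega), if_neg hi.ne]

theorem exists_monomial_eq_sum [CharZero K] (h : IsCentredGrid x₀ α A) {S : Finset (σ → K)}
    (hS : Fintype.piFinset A ⊆ S) : ∃ lam : S → K, monomial (single x₀ 1 + α) 1 =
      ∑ q : S, lam q • linearForm q.1 ^ (single x₀ 1 + α).degree := by
  classical
  set μ : K := ((single x₀ 1 + α).multinomial : K)
  refine ⟨fun q => if q.1 ∈ Fintype.piFinset A then μ⁻¹ * ∏ i, nodalWeight (A i) id (q.1 i) else 0,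
    monomial_eq_sum_smul_linearForm_pow_iff.mpr fun m hm => ?_⟩
  rw [← h.sum_prod_nodalWeight_mul_prod_pow hm, Finset.sum_coe_sort S fun q =>
    (if q ∈ Fintype.piFinset A then μ⁻¹ * ∏ i, nodalWeight (A i) id (q i) else 0) *
      ∏ i, q i ^ m i]
  simp only [ite_mul, zero_mul, Finset.sum_ite_mem, Finset.inter_eq_right.mpr hS, mul_assoc,
    ← Finset.mul_sum]
  exact mul_inv_cancel_left₀ (multinomial_cast_ne_zero _) _

end IsCentredGrid

end CentredGrids

section Ranks

variable {σ : Type*} {x₀ : σ} {α γ : σ →₀ ℕ}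

theorem totalDegree_monomial_one {R : Type*} [CommSemiring R] [Nontrivial R] (m : σ →₀ ℕ) :
    (monomial m (1 : R)).totalDegree = m.degree :=
  totalDegree_monomial m one_ne_zero

theorem simRank_eq_card {κ : Type*} [Fintype κ] {𝓕 : Set (MvPolynomial σ ℂ)}
    {L : κ → MvPolynomial σ ℂ} (hL : ∀ j, (L j).IsHomogeneous 1)
    (hdec : ∀ F ∈ 𝓕, ∃ lam : κ → ℂ, F = ∑ j, lam j • L j ^ F.totalDegree)
    (hmin : ∀ (r : ℕ) (L' : Fin r → MvPolynomial σ ℂ),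
      SimultaneouslyDecomposes L' 𝓕 → Fintype.card κ ≤ r) :
    simRank 𝓕 = Fintype.card κ := by
  let e : Fin (Fintype.card κ) ≃ κ := (Fintype.equivFin κ).symm
  have hmem : SimultaneouslyDecomposes (L ∘ e) 𝓕 := by
    refine ⟨fun j => hL (e j), fun F hF => ?_⟩
    obtain ⟨lam, hlam⟩ := hdec F hF
    exact ⟨lam ∘ e, hlam.trans (e.sum_comp fun j => lam j • L j ^ F.totalDegree).symm⟩
  exact le_antisymm (Nat.sInf_le ⟨_, hmem⟩)
    (le_csInf ⟨_, _, hmem⟩ fun r ⟨L', hL'⟩ => hmin r L' hL')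

theorem card_union_Iic_add_card_Iic_inf {β : Type*} [SemilatticeInf β] [LocallyFiniteOrderBot β]
    [DecidableEq β] (a b : β) :
    (Finset.Iic a ∪ Finset.Iic b).card + (Finset.Iic (a ⊓ b)).card =
      (Finset.Iic a).card + (Finset.Iic b).card := by
  have hinter : Finset.Iic a ∩ Finset.Iic b = Finset.Iic (a ⊓ b) := by
    ext e
    simp only [Finset.mem_inter, Finset.mem_Iic, le_inf_iff]
  rw [← hinter, Finset.card_union_add_card_inter]

theorem card_le_of_simultaneouslyDecomposes [Finite σ] {r : ℕ} {L : Fin r → MvPolynomial σ ℂ}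
    {𝓕 : Set (MvPolynomial σ ℂ)} (hL : SimultaneouslyDecomposes L 𝓕) {E : Finset (σ →₀ ℕ)}
    (hE : ∀ e ∈ E, e x₀ = 0) (h𝓕 : ∀ e ∈ E, ∃ α, e ≤ α ∧ monomial (single x₀ 1 + α) 1 ∈ 𝓕) :
    E.card ≤ r := by
  cases nonempty_fintype σ
  choose p hp using fun j => exists_linearForm_eq (hL.1 j)
  rw [← Fintype.card_fin r]
  refine card_le_card_of_isApolarFamily (p := p) hE fun e he => ?_
  obtain ⟨α, hα, hmem⟩ := h𝓕 e he
  obtain ⟨lam, hlam⟩ := hL.2 _ hmem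
  refine ⟨α, hα, isApolarFamily_of_monomial_eq_sum (lam := lam) ?_⟩
  simpa only [hp, totalDegree_monomial_one] using hlam

variable [DecidableEq σ]

theorem card_Iic_eq_prod [Fintype σ] (α : σ →₀ ℕ) : (Finset.Iic α).card = ∏ i, (α i + 1) := by
  rw [Finsupp.card_Iic, ← Finset.prod_subset (Finset.subset_univ α.support)]
  · exact Finset.prod_congr rfl fun i _ => Nat.card_Iic _
  · intro i _ hi
    rw [Finsupp.notMem_support_iff.mp hi, zero_add]

theorem IsCentredGrid.card_piFinset_union [Fintype σ] {K : Type*} [Field K]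
    [DecidableEq K] {A B : σ → Finset K} (hA : IsCentredGrid x₀ α A) (hB : IsCentredGrid x₀ γ B)
    (hAB : ∀ i, (A i ∩ B i).card = (α ⊓ γ) i + 1) :
    (Fintype.piFinset A ∪ Fintype.piFinset B).card = (Finset.Iic α ∪ Finset.Iic γ).card := by
  have hgrid := Finset.card_union_add_card_inter (Fintype.piFinset A) (Fintype.piFinset B)
  simp only [← Fintype.piFinset_inter, Fintype.card_piFinset, hA.card_eq, hB.card_eq, hAB,
    ← card_Iic_eq_prod] at hgrid
  exact Nat.add_right_cancel (hgrid.trans (card_union_Iic_add_card_Iic_inf α γ).symm)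

variable [Finite σ]

theorem simRank_pair_eq_card (hα : α x₀ = 0) (hγ : γ x₀ = 0)
    (h : ∀ i, (γ i = 0 → α i ≠ 1) ∧ (α i = 0 → γ i ≠ 1)) :
    simRank {monomial (single x₀ 1 + α) 1, monomial (single x₀ 1 + γ) 1} =
      (Finset.Iic α ∪ Finset.Iic γ).card := by
  cases nonempty_fintype σ
  obtain ⟨A, B, hA, hB, hAB⟩ := exists_isCentredGrid_pair (K := ℂ) hα hγ h
  have hcard := hA.card_piFinset_union hB hAB
  rw [← hcard, ← Fintype.card_coe]
  refine simRank_eq_card (fun q => isHomogeneous_linearForm q.1) ?_ fun r L hL => ?_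
  · rintro F (rfl | rfl) <;> rw [totalDegree_monomial_one]
    · exact hA.exists_monomial_eq_sum Finset.subset_union_left
    · exact hB.exists_monomial_eq_sum Finset.subset_union_right
  · rw [Fintype.card_coe, hcard]
    refine card_le_of_simultaneouslyDecomposes (x₀ := x₀) hL (fun e he => ?_) fun e he => ?_ <;>
      rw [Finset.mem_union, Finset.mem_Iic, Finset.mem_Iic] at he
    · obtain he | he := he
      · exact Nat.le_zero.mp (hα ▸ he x₀)
      · exact Nat.le_zero.mp (hγ ▸ he x₀)
    · obtain he | he := he
      · exact ⟨α, he, Set.mem_insert _ _⟩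
      · exact ⟨γ, he, Set.mem_insert_of_mem _ rfl⟩

theorem waringRank_monomial_eq_card (hα : α x₀ = 0) :
    waringRank (monomial (single x₀ 1 + α) 1) = (Finset.Iic α).card := by
  have := simRank_pair_eq_card hα hα fun i => ⟨by omega, by omega⟩
  rwa [Set.pair_eq_singleton, Finset.union_self] at this

end Ranks

section GreatestCommonDivisors

variable {σ : Type*} {F G G' A B : MvPolynomial σ ℂ}

theorem totalDegree_smul_of_ne_zero {R S : Type*} [CommSemiring R] [Semiring S] [IsDomain S]
    [Module S R] [Module.IsTorsionFree S R] (F : MvPolynomial σ R) {u : S} (hu : u ≠ 0) :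
    (u • F).totalDegree = F.totalDegree := by
  rw [totalDegree, support_smul_eq hu, ← totalDegree]

theorem SimultaneouslyDecomposes.smul {r : ℕ} {L : Fin r → MvPolynomial σ ℂ}
    (h : SimultaneouslyDecomposes L {F}) {u : ℂ} (hu : u ≠ 0) :
    SimultaneouslyDecomposes L {u • F} := by
  refine ⟨h.1, ?_⟩
  rintro _ rfl
  obtain ⟨lam, hlam⟩ := h.2 F rfl
  refine ⟨u • lam, ?_⟩
  calc u • F
    _ = u • ∑ j, lam j • L j ^ F.totalDegree := by rw [← hlam]
    _ = ∑ j, (u • lam) j • L j ^ (u • F).totalDegree := by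
      simp only [totalDegree_smul_of_ne_zero F hu, Finset.smul_sum, Pi.smul_apply, smul_assoc]

theorem waringRank_smul (F : MvPolynomial σ ℂ) {u : ℂ} (hu : u ≠ 0) :
    waringRank (u • F) = waringRank F := by
  have hiff (r : ℕ) (L : Fin r → MvPolynomial σ ℂ) :
      SimultaneouslyDecomposes L {u • F} ↔ SimultaneouslyDecomposes L {F} :=
    ⟨fun h => inv_smul_smul₀ hu F ▸ h.smul (inv_ne_zero hu), fun h => h.smul hu⟩
  simp only [waringRank, simRank, hiff]

theorem waringRank_eq_of_associated (h : Associated F G) : waringRank F = waringRank G := by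
  obtain ⟨u, rfl⟩ := h
  obtain ⟨v, hv, huv⟩ := isUnit_iff_eq_C_of_isReduced.mp u.isUnit
  rw [huv, mul_comm, ← smul_eq_C_mul, waringRank_smul F hv.ne_zero]

theorem IsGreatestCommonDivisor.associated (h : IsGreatestCommonDivisor G A B)
    (h' : IsGreatestCommonDivisor G' A B) : Associated G G' :=
  associated_of_dvd_dvd (h'.2.2 G h.1 h.2.1) (h.2.2 G' h'.1 h'.2.1)

theorem isGreatestCommonDivisor_monomial (m n : σ →₀ ℕ) :
    IsGreatestCommonDivisor (monomial (m ⊓ n) 1) (monomial m 1) (monomial n 1) := by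
  refine ⟨monomial_one_dvd_monomial_one.mpr inf_le_left,
    monomial_one_dvd_monomial_one.mpr inf_le_right, fun D hm hn => ?_⟩
  obtain ⟨k, u, hk, hu, rfl⟩ := (dvd_monomial_iff_exists one_ne_zero).mp hm
  have hkn := (monomial_dvd_monomial.mp hn).1.resolve_left one_ne_zero
  exact monomial_dvd_monomial.mpr ⟨.inr (le_inf hk hkn), hu⟩

theorem waringRank_eq_card_of_isGreatestCommonDivisor [Finite σ] [DecidableEq σ] {x₀ : σ}
    {α γ : σ →₀ ℕ} (hα : α x₀ = 0) (hG : IsGreatestCommonDivisor G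
      (monomial (single x₀ 1 + α) 1) (monomial (single x₀ 1 + γ) 1)) :
    waringRank G = (Finset.Iic (α ⊓ γ)).card := by
  have hinf : (single x₀ 1 + α) ⊓ (single x₀ 1 + γ) = single x₀ 1 + α ⊓ γ := by
    ext i
    exact min_add_add_left ..
  rw [waringRank_eq_of_associated (hG.associated (isGreatestCommonDivisor_monomial _ _)), hinf]
  exact waringRank_monomial_eq_card (by rw [Finsupp.inf_apply, hα, Nat.zero_min])

end GreatestCommonDivisors

namespace Var

variable {s r l : ℕ}

/-- The exponent of the monomial `∏ i, y i ^ a i * ∏ i, z i ^ b i * ∏ i, t i ^ d i`, which does not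
involve `x₀`. -/
noncomputable def exponent (a : Fin s → ℕ) (b : Fin r → ℕ) (d : Fin l → ℕ) : Var s r l →₀ ℕ :=
  Finsupp.equivFunOnFinite.symm fun v => v.elim 0 (Sum.elim a (Sum.elim b d))

theorem monomial_single_add_exponent {R : Type*} [CommSemiring R] (a : Fin s → ℕ)
    (b : Fin r → ℕ) (d : Fin l → ℕ) :
    monomial (single x₀ 1 + exponent a b d) (1 : R) =
      X x₀ * ((∏ i, X (y i) ^ a i) * ((∏ i, X (z i) ^ b i) * ∏ i, X (t i) ^ d i)) := by
  rw [monomial_single_add, pow_one, monomial_eq, C_1, one_mul,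
    Finsupp.prod_fintype _ _ fun _ => pow_zero _, Fintype.prod_option, Fintype.prod_sum_type,
    Fintype.prod_sum_type]
  simp only [exponent, Finsupp.equivFunOnFinite_symm_apply_apply, Option.elim_none,
    Option.elim_some, Sum.elim_inl, Sum.elim_inr, pow_zero, one_mul]
  rfl

theorem exponent_inf_exponent (a c : Fin s → ℕ) (b : Fin r → ℕ) (d : Fin l → ℕ) :
    exponent a b 0 ⊓ exponent c 0 d = exponent (a ⊓ c) 0 0 := by
  ext (_ | i | i | i)
  · rfl
  · rfl
  · exact Nat.min_zero (b i)
  · exact Nat.zero_min (d i)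

theorem card_Iic_exponent (a : Fin s → ℕ) (b : Fin r → ℕ) (d : Fin l → ℕ) :
    (Finset.Iic (exponent a b d)).card =
      (∏ i, (a i + 1)) * ((∏ i, (b i + 1)) * ∏ i, (d i + 1)) := by
  rw [card_Iic_eq_prod, Fintype.prod_option, Fintype.prod_sum_type, Fintype.prod_sum_type]
  exact one_mul _

end Var

theorem mainTheorem4 (s r l : ℕ) (a c : Fin s → ℕ) (b : Fin r → ℕ) (d : Fin l → ℕ)
    (hb : ∀ i, 2 ≤ b i) (hd : ∀ i, 2 ≤ d i)
    (hac : ∀ i, (c i = 0 → a i ≠ 1) ∧ (a i = 0 → c i ≠ 1))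
    (M₁ M₂ M₁₂ : MvPolynomial (Var s r l) ℂ)
    (hM₁ : M₁ = X Var.x₀ * (∏ i, X (Var.y i) ^ a i) * ∏ i, X (Var.z i) ^ b i)
    (hM₂ : M₂ = X Var.x₀ * (∏ i, X (Var.y i) ^ c i) * ∏ i, X (Var.t i) ^ d i)
    (hM₁₂ : IsGreatestCommonDivisor M₁₂ M₁ M₂) :
    ((simRank {M₁, M₂} : ℤ) = (waringRank M₁ : ℤ) + (waringRank M₂ : ℤ) - (waringRank M₁₂ : ℤ)) ∧
    (s = 0 → (simRank {M₁, M₂} : ℤ) = (waringRank M₁ : ℤ) + (waringRank M₂ : ℤ) - 1) := by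
  let α : Var s r l →₀ ℕ := Var.exponent a b 0
  let γ : Var s r l →₀ ℕ := Var.exponent c 0 d
  obtain rfl : M₁ = monomial (single Var.x₀ 1 + α) 1 := by
    simp [hM₁, α, Var.monomial_single_add_exponent, mul_assoc]
  obtain rfl : M₂ = monomial (single Var.x₀ 1 + γ) 1 := by
    simp [hM₂, γ, Var.monomial_single_add_exponent, mul_assoc]
  have hexponents : ∀ v, (γ v = 0 → α v ≠ 1) ∧ (α v = 0 → γ v ≠ 1) := by
    rintro (_ | i | i | i)
    · exact ⟨fun _ => zero_ne_one, fun _ => zero_ne_one⟩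
    · exact hac i
    · exact ⟨fun _ => (Nat.lt_of_succ_le (hb i)).ne', fun _ => zero_ne_one⟩
    · exact ⟨fun _ => zero_ne_one, fun _ => (Nat.lt_of_succ_le (hd i)).ne'⟩
  have hM₁₂card : waringRank M₁₂ = (Finset.Iic (α ⊓ γ)).card :=
    waringRank_eq_card_of_isGreatestCommonDivisor rfl hM₁₂
  have hsum := card_union_Iic_add_card_Iic_inf α γ
  rw [simRank_pair_eq_card (α := α) (γ := γ) rfl rfl hexponents,
    waringRank_monomial_eq_card (α := α) rfl, waringRank_monomial_eq_card (α := γ) rfl, hM₁₂card]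
  refine ⟨by omega, ?_⟩
  rintro rfl
  have hone : (Finset.Iic (α ⊓ γ)).card = 1 := by
    simp [α, γ, Var.exponent_inf_exponent, Var.card_Iic_exponent]
  omega
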